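/- All Hilbert spaces are finite-dimensional with fixed orthonormal bases. Let $M$ parties be given, where party $i$ holds systems $A_i$, $\hat A_i$ and $A'_i$, and write $A_1^M=A_1\cdots A_M$, and similarly $\hat A_1^M$, $A_1^{\prime M}$. Let $\mathcal N_{A_1^M\to A_1^{\prime M}}$ be a quantum channel (a completely positive trace-preserving map) and let $\rho_{\hat A_1^M}$ be a state (positive semi-definite, trace one). For a subset $S$ of the parties, $T_S$, $T_{\hat S}$, $T_{S'}$ denote the partial transposes on the systems $A_i$, $\hat A_i$, $A'_i$ with $i\in S$. A channel $\mathcal P_{A_1^M\hat A_1^M\to A_1^{\prime M}}$ is *completely PPT-preserving* (C-PPT-P) if $T_{S'}\circ\mathcal P\circ T_{S\hat S}$ is completely positive for every subset $S$ of the parties. It simulates $\mathcal N$ by $\widetilde{\mathcal N}^{\mathcal P}(\omega)=\mathcal P(\omega\otimes\rho)$, and the simulation error is $$e_{\mathrm{PPT}}(\mathcal N,\rho)=\inf_{\mathcal P\in\text{C-PPT-P}}\tfrac12\big\|\mathcal N-\widetilde{\mathcal N}^{\mathcal P}\big\|_\diamond,\qquad \|\mathcal N-\mathcal M\|_\diamond=\sup_{\omega_{RA_1^M}}\big\|(\mathrm{id}_R\otimes\mathcal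 N)(\omega)-(\mathrm{id}_R\otimes\mathcal M)(\omega)\big\|_1,$$ where the supremum is over all finite-dimensional systems $R$ and all states $\omega$ of $RA_1^M$, and $\|X\|_1=\operatorname{Tr}\sqrt{X^\dagger X}$. The Choi operator of $\mathcal N$ is $\Gamma^{\mathcal N}_{A_1^MA_1^{\prime M}}=(\mathrm{id}\otimes\mathcal N)(|\Gamma\rangle\langle\Gamma|)$ with $|\Gamma\rangle=\sum_i|i\rangle|i\rangle$. **Proposition.** The simulation error is the value of the following (feasible) semi-definite program: $$e_{\mathrm{PPT}}(\mathcal N,\rho)=\inf\ \mu$$ over all real $\mu\ge 0$ and all operators $Z_{A_1^MA_1^{\prime M}}\ge0$ and $P_{A_1^M\hat A_1^MA_1^{\prime M}}\ge0$ such that $$\mu I_{A_1^M}\ge \operatorname{Tr}_{A_1^{\prime M}}[Z_{A_1^MA_1^{\prime M}}],\qquad \operatorname{Tr}_{A_1^{\prime M}}[P_{A_1^M\hat A_1^MA_1^{\prime M}}]=I_{A_1^M\hat A_1^M},$$ $$Z_{A_1^MA_1^{\prime M}}\ \ge\ \Gamma^{\mathcal N}_{A_1^MA_1^{\prime M}}-\operatorname{Tr}_{\hat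 A_1^M}\!\big[T_{\hat A_1^M}(\rho_{\hat A_1^M})\,P_{A_1^M\hat A_1^MA_1^{\prime M}}\big],$$ $$T_{S\hat SS'}(P_{A_1^M\hat A_1^MA_1^{\prime M}})\ge0\quad\text{for every subset } S \text{ of the parties.}$$ -/

import Mathlib

open scoped Kronecker MatrixOrder ComplexOrder

noncomputable section

namespace ChannelSim

/-- Operators on a finite-dimensional Hilbert space with an orthonormal basis indexed by `n`. -/
abbrev Op (n : Type*) := Matrix n n ℂ

/-! ### Single systems: states, channels, Choi operators, diamond distance -/

/-- A quantum state: positive semi-definite with unit trace. -/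
def IsState {n : Type*} [Fintype n] (ρ : Op n) : Prop :=
  ρ.PosSemidef ∧ ρ.trace = 1

/-- The map `id_R ⊗ Φ`, applying `Φ` to the block of `X` at each pair of basis labels of `R`. -/
def idTensor (R : Type*) {C D : Type*} (Φ : Op C →ₗ[ℂ] Op D) (X : Op (R × C)) : Op (R × D) :=
  Matrix.of fun p q => Φ (Matrix.of fun a b => X (p.1, a) (q.1, b)) p.2 q.2

/-- Complete positivity: `id_R ⊗ Φ` preserves positivity for every finite-dimensional `R`. -/
def IsCompletelyPositive {C D : Type*} (Φ : Op C →ₗ[ℂ] Op D) : Prop :=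
  ∀ (r : ℕ) (X : Op (Fin r × C)), X.PosSemidef → (idTensor (Fin r) Φ X).PosSemidef

def IsTracePreserving {C D : Type*} [Fintype C] [Fintype D] (Φ : Op C →ₗ[ℂ] Op D) : Prop :=
  ∀ X : Op C, (Φ X).trace = X.trace

/-- A quantum channel: a completely positive and trace-preserving linear map. -/
def IsChannel {C D : Type*} [Fintype C] [Fintype D] (Φ : Op C →ₗ[ℂ] Op D) : Prop :=
  IsCompletelyPositive Φ ∧ IsTracePreserving Φ

/-- The unnormalized maximally entangled operator `|Γ⟩⟨Γ|` with `|Γ⟩ = ∑ i, |i⟩|i⟩`. -/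
def maxEnt (C : Type*) [DecidableEq C] : Op (C × C) :=
  Matrix.vecMulVec (fun p => if p.1 = p.2 then 1 else 0) (fun p => if p.1 = p.2 then 1 else 0)

/-- The Choi operator `(id_R ⊗ Φ)(|Γ⟩⟨Γ|)`, with `R` a copy of the input system. -/
def choi {C D : Type*} [DecidableEq C] (Φ : Op C →ₗ[ℂ] Op D) : Op (C × D) :=
  idTensor C Φ (maxEnt C)

/-- The partial trace over the second tensor factor. -/
def traceSnd {R D : Type*} [Fintype D] (X : Op (R × D)) : Op R :=
  Matrix.of fun r s => ∑ d, X (r, d) (s, d)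

/-- The trace norm `Tr √(X† X)`. -/
def traceNorm {n : Type*} [Fintype n] [DecidableEq n] (X : Op n) : ℝ :=
  (CFC.sqrt (X.conjTranspose * X)).trace.re

/-- The diamond distance `sup ‖(id_R ⊗ Φ)(ω) - (id_R ⊗ Ψ)(ω)‖₁`, over all finite-dimensional
reference systems `R` and all states `ω` of `R` and the input system. -/
def diamondDist {C D : Type*} [Fintype C] [Fintype D] [DecidableEq D]
    (Φ Ψ : Op C →ₗ[ℂ] Op D) : ℝ :=
  sSup {t | ∃ (r : ℕ) (ω : Op (Fin r × C)), IsState ω ∧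
    t = traceNorm (idTensor (Fin r) Φ ω - idTensor (Fin r) Ψ ω)}

/-! ### Multipartite systems

The parties are the elements of a finite type `ι`, and party `i` holds a system with basis
labels `B i`; the joint system has the product basis, labelled by `∀ i, B i`. -/

section Multipartite

variable {ι : Type*} [DecidableEq ι]

/-- The partial transpose on the systems of the parties in `S`: the row and column labels
of these parties are exchanged. -/
def partialTranspose {B : ι → Type*} (S : Finset ι) : Op (∀ i, B i) →ₗ[ℂ] Op (∀ i, B i) where
  toFun X := Matrix.of fun x y => X (S.piecewise y x) (S.piecewise x y)
  map_add' _ _ := rfl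
  map_smul' _ _ := rfl

/-- The partial transpose, for an operator on the joint input and output systems, on the input
and output systems of the parties in `S`. -/
def partialTransposeInOut {B C : ι → Type*} (S : Finset ι)
    (X : Op ((∀ i, B i) × (∀ i, C i))) : Op ((∀ i, B i) × (∀ i, C i)) :=
  Matrix.of fun p q =>
    X (S.piecewise q.1 p.1, S.piecewise q.2 p.2) (S.piecewise p.1 q.1, S.piecewise p.2 q.2)

variable [Fintype ι]

/-- Completely PPT-preserving channels: channels `𝒫` such that `T_{S'} ∘ 𝒫 ∘ T_S` is completely
positive for every set `S` of parties. -/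
def IsCPPTP {B C : ι → Type*} [∀ i, Fintype (B i)] [∀ i, Fintype (C i)]
    (P : Op (∀ i, B i) →ₗ[ℂ] Op (∀ i, C i)) : Prop :=
  IsChannel P ∧
    ∀ S : Finset ι, IsCompletelyPositive (partialTranspose S ∘ₗ P ∘ₗ partialTranspose S)

variable {A Ahat A' : ι → Type*}

/-- `ω ⊗ ρ`, with its tensor factors grouped by party: party `i` holds `A i` and `Ahat i`. -/
def jointInput (ω : Op (∀ i, A i)) (ρ : Op (∀ i, Ahat i)) : Op (∀ i, A i × Ahat i) :=
  (ω ⊗ₖ ρ).submatrix (Equiv.arrowProdEquivProdArrow ι A Ahat)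
    (Equiv.arrowProdEquivProdArrow ι A Ahat)

/-- The simulation `ω ↦ 𝒫(ω ⊗ ρ)`. -/
def simulation (P : Op (∀ i, A i × Ahat i) →ₗ[ℂ] Op (∀ i, A' i)) (ρ : Op (∀ i, Ahat i)) :
    Op (∀ i, A i) →ₗ[ℂ] Op (∀ i, A' i) where
  toFun ω := P (jointInput ω ρ)
  map_add' ω ω' := by
    rw [← map_add]
    congr 1
    ext x y
    simp [jointInput, add_mul]
  map_smul' c ω := by
    rw [RingHom.id_apply, ← map_smul]
    congr 1
    ext x y
    simp [jointInput, mul_assoc]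

variable [∀ i, Fintype (A i)] [∀ i, Fintype (Ahat i)] [∀ i, Fintype (A' i)]
  [∀ i, DecidableEq (A i)] [∀ i, DecidableEq (Ahat i)] [∀ i, DecidableEq (A' i)]

/-- The error of simulating `N` with the C-PPT-P channel `P` and the resource state `ρ`. -/
def simError (N : Op (∀ i, A i) →ₗ[ℂ] Op (∀ i, A' i)) (ρ : Op (∀ i, Ahat i))
    (P : Op (∀ i, A i × Ahat i) →ₗ[ℂ] Op (∀ i, A' i)) : ℝ :=
  1 / 2 * diamondDist N (simulation P ρ)

/-- The simulation error minimized over all C-PPT-P channels. -/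
def ePPT (N : Op (∀ i, A i) →ₗ[ℂ] Op (∀ i, A' i)) (ρ : Op (∀ i, Ahat i)) : ℝ :=
  sInf {e | ∃ P : Op (∀ i, A i × Ahat i) →ₗ[ℂ] Op (∀ i, A' i), IsCPPTP P ∧ e = simError N ρ P}

/-- `Tr_Ahat [T_Ahat(ρ) P]`, where `T_Ahat(ρ)` stands for `I_A ⊗ T_Ahat(ρ) ⊗ I_A'`. -/
def contractResource (ρ : Op (∀ i, Ahat i)) (P : Op ((∀ i, A i × Ahat i) × (∀ i, A' i))) :
    Op ((∀ i, A i) × (∀ i, A' i)) :=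
  let e := (Equiv.arrowProdEquivProdArrow ι A Ahat).prodCongr (Equiv.refl (∀ i, A' i))
  let Q : Op (((∀ i, A i) × (∀ i, Ahat i)) × (∀ i, A' i)) :=
    (((1 : Op (∀ i, A i)) ⊗ₖ ρ.transpose) ⊗ₖ (1 : Op (∀ i, A' i))) * P.submatrix e.symm e.symm
  Matrix.of fun p q => ∑ h, Q ((p.1, h), p.2) ((q.1, h), q.2)

/-- The feasible points `(μ, Z, P)` of the semi-definite program. -/
structure SDPFeasible (N : Op (∀ i, A i) →ₗ[ℂ] Op (∀ i, A' i)) (ρ : Op (∀ i, Ahat i))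
    (μ : ℝ) (Z : Op ((∀ i, A i) × (∀ i, A' i)))
    (P : Op ((∀ i, A i × Ahat i) × (∀ i, A' i))) : Prop where
  mu_nonneg : 0 ≤ μ
  Z_nonneg : Z.PosSemidef
  P_nonneg : P.PosSemidef
  /-- `μ I ≥ Tr_A'[Z]` -/
  trace_le : ((μ : ℂ) • (1 : Op (∀ i, A i)) - traceSnd Z).PosSemidef
  /-- `Tr_A'[P] = I` -/
  trace_eq : traceSnd P = 1
  /-- `Z ≥ Γ^N - Tr_Ahat[T_Ahat(ρ) P]` -/
  diff_le : (Z - (choi N - contractResource ρ P)).PosSemidef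
  /-- all partial transposes of `P` are positive semi-definite -/
  ppt : ∀ S : Finset ι, (partialTransposeInOut S P).PosSemidef

end Multipartite

end ChannelSim

end

/-! Everything is translated to Choi operators, and the diamond distance is then computed by convex
duality.

A linear map is a C-PPT-P channel exactly when its Choi operator `P` satisfies the constraints on
`P` (`isCPPTP_iff_choi`), and every `P` is the Choi operator of some map (`choi_ofChoi`). The
simulation has Choi operator `contractResource ρ P` (`choi_simulation`). For a fixed channel it
remains to see that half the diamond distance is the infimum of the `μ` with `Z ≥ 0`, `Z ≥ J`, `μ I
≥ Tr_D Z`, where `J` is the difference of the Choi operators.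

Trace preservation gives `Tr_D J = 0`, so every output difference `K` is traceless and half its
trace norm is `Tr K⁺`, the least trace of a `Y ≥ 0` with `Y ≥ K`. Weak duality (`traceNorm_link_le`)
takes for `Y` the operator obtained from `Z`. Conversely, for an invertible marginal `σ` of a pure
input, `K⁺` pulls back to a `Z` with `Tr[σ Tr_D Z] = Tr K⁺` (`exists_of_posDef_state`). Sion's
minimax theorem replaces these `σ`-dependent `Z` by one good for all states
(`exists_of_traceNorm_link_le`). -/

namespace ChannelSim

open Matrix

/-! ### Choi operators and Choi's theorem -/

section SingleSystem

variable {R C D : Type*} [Fintype C]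

/-- The contraction of the `C`-systems of `X` and of a Choi operator `J`. -/
def link (X : Op (R × C)) (J : Op (C × D)) : Op (R × D) :=
  Matrix.of fun p q => ∑ a, ∑ b, X (p.1, a) (q.1, b) * J (a, p.2) (b, q.2)

theorem link_sub (X : Op (R × C)) (J J' : Op (C × D)) :
    link X (J - J') = link X J - link X J' := by
  ext p q
  simp [link, mul_sub, Finset.sum_sub_distrib]

/-- The contraction is a congruence of `X ⊗ J` by the 0-1 matrix `V` that pairs the two copies of
`C` through the vector `|Γ⟩`. -/
theorem link_posSemidef [Fintype R] [Fintype D] {X : Op (R × C)} {J : Op (C × D)}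
    (hX : X.PosSemidef) (hJ : J.PosSemidef) : (link X J).PosSemidef := by
  classical
  let V : Matrix ((R × C) × (C × D)) (R × D) ℂ :=
    Matrix.of fun x p => if x.1.1 = p.1 ∧ x.1.2 = x.2.1 ∧ x.2.2 = p.2 then 1 else 0
  have h := (hX.kronecker hJ).conjTranspose_mul_mul_same V
  suffices h1 : link X J = Vᴴ * (X ⊗ₖ J) * V from h1 ▸ h
  ext ⟨r, d⟩ ⟨s, e⟩
  simp only [link, of_apply, mul_apply, conjTranspose_apply, V, Fintype.sum_prod_type,
    kroneckerMap_apply]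
  simp only [ite_and, apply_ite star, star_one, star_zero, ite_mul, zero_mul, one_mul, mul_ite,
    mul_one, mul_zero, Finset.sum_ite_eq, Finset.sum_ite_eq', Finset.mem_univ, if_true,
    Finset.sum_ite_irrel, Finset.sum_const_zero]
  rw [Finset.sum_comm]

/-- The linear map with Choi operator `J`. -/
def ofChoi (J : Op (C × D)) : Op C →ₗ[ℂ] Op D where
  toFun X := Matrix.of fun d e => ∑ a, ∑ b, X a b * J (a, d) (b, e)
  map_add' X Y := by
    ext d e
    simp [add_mul, Finset.sum_add_distrib]
  map_smul' c X := by
    ext d e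
    simp [Finset.mul_sum, mul_assoc]

variable [DecidableEq C]

omit [Fintype C] in
theorem choi_apply (Φ : Op C →ₗ[ℂ] Op D) (p q : C × D) :
    choi Φ p q = Φ (Matrix.single p.1 q.1 1) p.2 q.2 := by
  simp only [choi, idTensor, maxEnt, of_apply, vecMulVec_apply]
  refine congrArg (fun X => Φ X p.2 q.2) (Matrix.ext fun a b => ?_)
  simp only [of_apply, single_apply, ite_and]
  split_ifs <;> simp

theorem choi_ofChoi (J : Op (C × D)) : choi (ofChoi J) = J := by
  ext ⟨a, d⟩ ⟨b, e⟩
  simp [choi_apply, ofChoi, single_apply, ite_and, Finset.sum_ite_irrel]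

theorem apply_eq_sum_choi (Φ : Op C →ₗ[ℂ] Op D) (X : Op C) (d e : D) :
    Φ X d e = ∑ a, ∑ b, X a b * choi Φ (a, d) (b, e) := by
  conv_lhs => rw [matrix_eq_sum_single X]
  simp only [map_sum, Matrix.sum_apply, choi_apply]
  refine Finset.sum_congr rfl fun a _ => Finset.sum_congr rfl fun b _ => ?_
  rw [← mul_one (X a b), ← smul_eq_mul (X a b) 1, ← Matrix.smul_single, map_smul]
  simp

theorem idTensor_eq_link (Φ : Op C →ₗ[ℂ] Op D) (X : Op (R × C)) :
    idTensor R Φ X = link X (choi Φ) := by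
  ext p q
  simp [idTensor, link, apply_eq_sum_choi Φ]

theorem maxEnt_posSemidef : (maxEnt C).PosSemidef := by
  have h := posSemidef_vecMulVec_self_star (fun p : C × C => if p.1 = p.2 then (1 : ℂ) else 0)
  convert h using 1
  unfold maxEnt
  congr 1
  ext p
  simp [apply_ite star]

theorem isCompletelyPositive_iff_choi [Fintype D] (Φ : Op C →ₗ[ℂ] Op D) :
    IsCompletelyPositive Φ ↔ (choi Φ).PosSemidef := by
  refine ⟨fun h => ?_, fun h r X hX => ?_⟩
  -- Complete positivity only tests the references `Fin r`, so the copy of `C` carrying `|Γ⟩⟨Γ|` is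
  -- relabelled and then relabelled back.
  · let e := Fintype.equivFin C
    have h1 := h _ _ (maxEnt_posSemidef (C := C) |>.submatrix (Prod.map e.symm id))
    have h2 := h1.submatrix (Prod.map e id)
    convert h2 using 1
    ext p q
    simp [choi, idTensor]
  · rw [idTensor_eq_link]
    exact link_posSemidef hX h

theorem isTracePreserving_iff_choi [Fintype D] (Φ : Op C →ₗ[ℂ] Op D) :
    IsTracePreserving Φ ↔ traceSnd (choi Φ) = 1 := by
  have key (X : Op C) : (Φ X).trace = ∑ a, ∑ b, X a b * traceSnd (choi Φ) a b := by
    simp only [Matrix.trace, diag_apply, apply_eq_sum_choi Φ, traceSnd, of_apply, Finset.mul_sum]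
    rw [Finset.sum_comm]
    exact Finset.sum_congr rfl fun a _ => Finset.sum_comm
  refine ⟨fun h => ?_, fun h X => ?_⟩
  · ext a b
    have h1 := h (Matrix.single a b 1)
    rw [key] at h1
    simp only [single_apply, ite_and, ite_mul, one_mul, zero_mul, Finset.sum_ite_irrel,
      Finset.sum_const_zero, Finset.sum_ite_eq, Finset.mem_univ, if_true] at h1
    rw [h1, one_apply]
    by_cases hab : a = b
    · subst hab; simp
    · simp [hab]
  · rw [key, h]
    simp [one_apply, Matrix.trace]

omit [DecidableEq C] in
theorem trace_link [Fintype R] [Fintype D] (X : Op (R × C)) (Z : Op (C × D)) :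
    (link X Z).trace = ∑ r, ∑ a, ∑ b, X (r, a) (r, b) * traceSnd Z a b := by
  simp only [Matrix.trace, diag_apply, link, traceSnd, of_apply, Finset.mul_sum,
    Fintype.sum_prod_type]
  refine Finset.sum_congr rfl fun r _ => ?_
  rw [Finset.sum_comm]
  exact Finset.sum_congr rfl fun a _ => Finset.sum_comm

theorem trace_link_le [Fintype R] [Fintype D] {X : Op (R × C)} {Z : Op (C × D)} {μ : ℝ}
    (hX : IsState X) (h : ((μ : ℂ) • (1 : Op C) - traceSnd Z).PosSemidef) :
    (link X Z).trace.re ≤ μ := by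
  -- A one-dimensional output `Unit` turns `μ I - Tr_D Z` into a Choi operator; the trace of its
  -- contraction with `X` is `μ - Tr (link X Z)`.
  have h1 := (link_posSemidef hX.1 (h.submatrix (Prod.fst : C × Unit → C))).trace_nonneg
  rw [trace_link] at h1
  have h2 : ∑ r, ∑ a, ∑ b, X (r, a) (r, b) *
      traceSnd (((μ : ℂ) • (1 : Op C) - traceSnd Z).submatrix
        (Prod.fst : C × Unit → C) Prod.fst) a b = μ * X.trace - (link X Z).trace := by
    rw [trace_link]
    simp [traceSnd, mul_sub, Finset.sum_sub_distrib, one_apply, Matrix.trace,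
      Fintype.sum_prod_type, Finset.mul_sum, mul_comm]
  rw [h2, hX.2, mul_one] at h1
  have h3 := (Complex.le_def.1 h1).1
  simpa using h3

end SingleSystem

/-! ### Trace norm and positive part -/

section TraceNorm

variable {n : Type*} [Fintype n] [DecidableEq n]

theorem traceNorm_nonneg (X : Op n) : 0 ≤ traceNorm X := by
  have h := (nonneg_iff_posSemidef.1 (CFC.sqrt_nonneg (Xᴴ * X))).trace_nonneg
  exact (Complex.le_def.1 h).1

/-- Take traces in `|X| + X = 2 X⁺`. -/
theorem traceNorm_eq {X : Op n} (hX : X.IsHermitian) (h0 : X.trace = 0) :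
    traceNorm X = 2 * (X⁺).trace.re := by
  have h := congrArg Matrix.trace (CFC.abs_add_self X hX)
  rw [trace_add, h0, add_zero, trace_smul] at h
  have h1 : traceNorm X = (CFC.abs X).trace.re := rfl
  rw [h1, h]
  simp

/-- With `Q` the spectral projection of `X` onto its positive eigenvalues, `Tr X⁺ = Tr QX ≤ Tr QY ≤
Tr Y`. -/
theorem trace_posPart_le {X Y : Op n} (hX : X.IsHermitian) (hY : Y.PosSemidef)
    (hXY : (Y - X).PosSemidef) : (X⁺).trace.re ≤ Y.trace.re := by
  classical
  have hX' : IsSelfAdjoint X := hX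
  have hc (f : ℝ → ℝ) : ContinuousOn f (spectrum ℝ X) := X.finite_real_spectrum.continuousOn f
  set Q : Op n := cfc (fun x : ℝ => if 0 < x then 1 else 0) X with hQ
  have hQs : Qᴴ = Q := (cfc_predicate _ X : IsSelfAdjoint Q)
  have hQQ : Q * Q = Q := by
    rw [hQ, ← cfc_mul _ _ X (hc _) (hc _)]
    congr 1
    ext x
    simp
  have hQX : Q * X = X⁺ := by
    rw [CFC.posPart_def, cfcₙ_eq_cfc]
    trans Q * cfc (id : ℝ → ℝ) X
    · rw [cfc_id ℝ X hX']
    rw [hQ, ← cfc_mul _ _ X (hc _) (hc _)]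
    congr 1
    ext x
    by_cases h : 0 < x
    · simp [h, h.le]
    · simp [h, not_lt.1 h]
  have tr (P : Op n) (hP : P * P = P) (hPs : Pᴴ = P) (W : Op n) (hW : W.PosSemidef) :
      0 ≤ (P * W).trace.re := by
    have h := (hW.conjTranspose_mul_mul_same P).trace_nonneg
    rw [hPs, trace_mul_comm, ← mul_assoc, hP] at h
    exact (Complex.le_def.1 h).1
  have h1 := tr Q hQQ hQs _ hXY
  have h2 := tr (1 - Q) (by simp [mul_sub, sub_mul, hQQ]) (by simp [hQs]) _ hY
  rw [mul_sub, hQX, trace_sub, Complex.sub_re] at h1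
  rw [sub_mul, one_mul, trace_sub, Complex.sub_re] at h2
  linarith

end TraceNorm

/-! ### The compact convex set of states -/

section States

variable {C D : Type*} [Fintype C]

/-- Nonnegativity of the 2×2 minor on `i, j` gives `|σ i j|² ≤ σ i i * σ j j ≤ 1`. This bounds the
set of states, and also the value at the feasible point of `exists_feasible`. -/
theorem IsState.norm_apply_le_one {σ : Op C} (hσ : IsState σ) (i j : C) : ‖σ i j‖ ≤ 1 := by
  have hd (k : C) : 0 ≤ (σ k k).re ∧ (σ k k).re ≤ 1 ∧ (σ k k).im = 0 := by
    have h0 (k : C) : 0 ≤ σ k k := hσ.1.diag_nonneg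
    have h1 : σ k k ≤ σ.trace :=
      Finset.single_le_sum (f := fun k => σ k k) (fun k _ => h0 k) (Finset.mem_univ k)
    rw [hσ.2] at h1
    have h2 := Complex.le_def.1 (h0 k)
    have h3 := Complex.le_def.1 h1
    exact ⟨h2.1, h3.1, h2.2.symm⟩
  have h := (hσ.1.submatrix ![i, j]).det_nonneg
  have hs : σ j i = star (σ i j) := (hσ.1.isHermitian.apply j i).symm
  rw [det_fin_two] at h
  simp only [submatrix_apply, cons_val_zero, cons_val_one, hs] at h
  have h1 := (Complex.le_def.1 h).1
  obtain ⟨hi0, hi1, hi⟩ := hd i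
  obtain ⟨hj0, hj1, hj⟩ := hd j
  have h2 : (σ i j * star (σ i j)).re = ‖σ i j‖ ^ 2 := by
    rw [Complex.star_def, Complex.mul_conj, Complex.ofReal_re, Complex.normSq_eq_norm_sq]
  rw [Complex.sub_re, h2, Complex.mul_re, hi, hj, Complex.zero_re] at h1
  nlinarith [norm_nonneg (σ i j), mul_le_one₀ hi1 hj0 hj1]

theorem isCompact_setOf_isState : IsCompact {σ : Op C | IsState σ} := by
  have hK : IsCompact (Set.univ.pi fun _ : C => Set.univ.pi fun _ : C =>
      Metric.closedBall (0 : ℂ) 1) :=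
    isCompact_univ_pi fun _ => isCompact_univ_pi fun _ => isCompact_closedBall _ _
  refine IsCompact.of_isClosed_subset (X := C → C → ℂ) hK ?_ fun σ hσ i _ j _ => ?_
  · have h1 : IsClosed {σ : Op C | σ.trace = 1} :=
      isClosed_eq continuous_id.matrix_trace continuous_const
    have h2 : IsClosed {σ : Op C | σᴴ = σ} :=
      isClosed_eq continuous_id.matrix_conjTranspose continuous_id
    have h3 : IsClosed {σ : Op C | ∀ x : C → ℂ, 0 ≤ star x ⬝ᵥ (σ *ᵥ x)} := by
      rw [Set.ofPred_forall]
      refine isClosed_iInter fun x => isClosed_le continuous_const ?_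
      exact continuous_const.dotProduct (continuous_id.matrix_mulVec continuous_const)
    have he : {σ : Op C | IsState σ} =
        ({σ | σᴴ = σ} ∩ {σ | ∀ x : C → ℂ, 0 ≤ star x ⬝ᵥ (σ *ᵥ x)}) ∩ {σ | σ.trace = 1} := by
      ext σ
      exact and_congr_left' posSemidef_iff_dotProduct_mulVec
    exact he ▸ (h2.inter h3).inter h1
  · simpa using hσ.norm_apply_le_one i j

theorem convex_setOf_isState : Convex ℝ {σ : Op C | IsState σ} := by
  rintro σ ⟨hσ, hσ1⟩ τ ⟨hτ, hτ1⟩ a b ha hb hab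
  refine ⟨(hσ.smul ha).add (hτ.smul hb), ?_⟩
  rw [trace_add, trace_smul, trace_smul, hσ1, hτ1, ← add_smul, hab, one_smul]

theorem posSemidef_of_forall_isState {W : Op C} (hW : W.IsHermitian)
    (h : ∀ σ, IsState σ → 0 ≤ (σ * W).trace.re) : W.PosSemidef := by
  refine PosSemidef.of_dotProduct_mulVec_nonneg hW fun x => ?_
  have him : (star x ⬝ᵥ (W *ᵥ x)).im = 0 := hW.im_star_dotProduct_mulVec_self x
  refine Complex.le_def.2 ⟨?_, him.symm⟩
  by_cases hx : x = 0
  · simp [hx]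
  have hpos : 0 < star x ⬝ᵥ x := dotProduct_star_self_pos_iff.2 hx
  set s := star x ⬝ᵥ x with hs
  have hs' : s = (s.re : ℂ) := Complex.ext rfl (Complex.lt_def.1 hpos).2.symm
  have hre : 0 < s.re := (Complex.lt_def.1 hpos).1
  have hst : IsState (s.re⁻¹ • vecMulVec x (star x)) := by
    refine ⟨(posSemidef_vecMulVec_self_star x).smul (inv_nonneg.2 hre.le), ?_⟩
    rw [trace_smul, trace_vecMulVec, dotProduct_comm, ← hs]
    conv_lhs => rw [hs']
    rw [Complex.ofReal_re, Complex.real_smul, ← Complex.ofReal_mul, inv_mul_cancel₀ hre.ne',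
      Complex.ofReal_one]
  have h1 := h _ hst
  rw [smul_mul_assoc, trace_smul, vecMulVec_mul, trace_vecMulVec, dotProduct_comm,
    ← dotProduct_mulVec, Complex.smul_re, smul_eq_mul] at h1
  exact nonneg_of_mul_nonneg_right h1 (inv_pos.2 hre)

end States

/-! ### Weak and strong duality for a fixed Choi operator -/

section Duality

variable {R C D : Type*} [Fintype R] [Fintype C] [Fintype D]

omit [Fintype R] [Fintype D] in
theorem link_isHermitian {X : Op (R × C)} {J : Op (C × D)} (hX : X.IsHermitian)
    (hJ : J.IsHermitian) : (link X J).IsHermitian := by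
  ext p q
  simp only [conjTranspose_apply, link, of_apply, star_sum, star_mul', hX.apply, hJ.apply]
  exact Finset.sum_comm

omit [Fintype C] in
theorem traceSnd_isHermitian {Z : Op (C × D)} (hZ : Z.IsHermitian) : (traceSnd Z).IsHermitian := by
  ext a b
  simp only [conjTranspose_apply, traceSnd, of_apply, star_sum, hZ.apply]

omit [Fintype C] in
theorem traceSnd_sub (Z W : Op (C × D)) : traceSnd (Z - W) = traceSnd Z - traceSnd W := by
  ext a b
  simp [traceSnd]

theorem trace_mul_traceSnd [DecidableEq D] (σ : Op C) (Z : Op (C × D)) :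
    (σ * traceSnd Z).trace = ((σ ⊗ₖ (1 : Op D)) * Z).trace := by
  simp only [Matrix.trace, diag_apply, mul_apply, traceSnd, of_apply, Fintype.sum_prod_type,
    kroneckerMap_apply, one_apply, mul_ite, mul_one, mul_zero, ite_mul, zero_mul,
    Finset.sum_ite_eq, Finset.mem_univ, if_true, Finset.mul_sum]
  exact Finset.sum_congr rfl fun a _ => Finset.sum_comm

variable [DecidableEq C] [DecidableEq D]

/-- Weak duality: feasible points bound the trace norm of the output. -/
theorem traceNorm_link_le [DecidableEq R] {ω : Op (R × C)} {J Z : Op (C × D)} {μ : ℝ}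
    (hω : IsState ω)
    (hJ : J.IsHermitian) (hJ0 : traceSnd J = 0) (hZ : Z.PosSemidef) (hZJ : (Z - J).PosSemidef)
    (hμ : ((μ : ℂ) • (1 : Op C) - traceSnd Z).PosSemidef) :
    traceNorm (link ω J) ≤ 2 * μ := by
  have hK := link_isHermitian hω.1.isHermitian hJ
  rw [traceNorm_eq hK (by simp [trace_link, hJ0])]
  have h1 := trace_posPart_le hK (link_posSemidef hω.1 hZ)
    (by rw [← link_sub]; exact link_posSemidef hω.1 hZJ)
  have h2 := trace_link_le hω hμ
  linarith

-- A pure input vector reshaped as a matrix `M` acts on `J` by congruence, so an invertible `M`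
-- allows `J` to be recovered from the output.
omit [Fintype R] [DecidableEq C] in
theorem link_vecMulVec (M : Matrix R C ℂ) (J : Op (C × D)) :
    link (vecMulVec (fun p : R × C => M p.1 p.2) (star fun p : R × C => M p.1 p.2)) J =
      (M ⊗ₖ (1 : Op D)) * J * (M ⊗ₖ (1 : Op D))ᴴ := by
  ext ⟨r, d⟩ ⟨s, e⟩
  simp only [link, of_apply, mul_apply, conjTranspose_apply, Fintype.sum_prod_type,
    kroneckerMap_apply, vecMulVec_apply, Pi.star_apply, one_apply, mul_ite, mul_one, mul_zero,
    ite_mul, zero_mul, apply_ite star, star_zero, Finset.sum_ite_eq, Finset.mem_univ, if_true,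
    Finset.sum_mul]
  rw [Finset.sum_comm]
  exact Finset.sum_congr rfl fun a _ => Finset.sum_congr rfl fun b _ => by ring

/-- `M` is `√σ` with its rows relabelled by `Fin`: the coefficient matrix of a purification of `σ`
with an admissible reference. `L` is its inverse. -/
theorem exists_sqrt_reindex {σ : Op C} (hσ : σ.PosDef) :
    ∃ (M : Matrix (Fin (Fintype.card C)) C ℂ) (L : Matrix C (Fin (Fintype.card C)) ℂ),
      Mᴴ * M = σ ∧ M * L = 1 ∧ L * M = 1 := by
  let e := Fintype.equivFin C
  set s := CFC.sqrt σ with hs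
  have hss : s * s = σ := CFC.sqrt_mul_sqrt_self σ (nonneg_iff_posSemidef.2 hσ.posSemidef)
  have hsh : sᴴ = s := (nonneg_iff_posSemidef.1 (CFC.sqrt_nonneg σ)).isHermitian
  have hu : IsUnit s.det := by
    have h := congrArg Matrix.det hss
    rw [det_mul] at h
    refine isUnit_iff_ne_zero.2 fun h0 => hσ.det_pos.ne' ?_
    rw [← h, h0, mul_zero]
  refine ⟨s.submatrix e.symm id, s⁻¹.submatrix id e.symm, ?_, ?_, ?_⟩
  · rw [conjTranspose_submatrix, hsh, submatrix_mul_equiv s s id e.symm id, hss, submatrix_id_id]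
  · rw [← submatrix_mul s s⁻¹ e.symm id e.symm Function.bijective_id, mul_nonsing_inv _ hu,
      submatrix_one_equiv]
  · rw [submatrix_mul_equiv s⁻¹ s id e.symm id, nonsing_inv_mul _ hu, submatrix_id_id]

/-- Congruence by `M ⊗ 1` sends `J` to the output `K` of the purification. Pulling `K⁺` back by the
inverse congruence preserves both inequalities, and `σ ⊗ 1 = M'ᴴ M'` turns the objective into `Tr K⁺
≤ t`. -/
theorem exists_of_posDef_state {J : Op (C × D)} {t : ℝ} (hJ : J.IsHermitian)
    (hJ0 : traceSnd J = 0)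
    (ht : ∀ (r : ℕ) (ω : Op (Fin r × C)), IsState ω → traceNorm (link ω J) ≤ 2 * t)
    {σ : Op C} (hσ : σ.PosDef) (hσ1 : σ.trace = 1) :
    ∃ Z : Op (C × D), Z.PosSemidef ∧ (Z - J).PosSemidef ∧ (σ * traceSnd Z).trace.re ≤ t := by
  obtain ⟨M, L, hMM, hML, hLM⟩ := exists_sqrt_reindex hσ
  set v : Fin (Fintype.card C) × C → ℂ := fun p => M p.1 p.2 with hv
  have hω : IsState (vecMulVec v (star v)) := by
    refine ⟨posSemidef_vecMulVec_self_star v, ?_⟩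
    rw [← hσ1, ← hMM]
    simp only [Matrix.trace, diag_apply, vecMulVec_apply, Fintype.sum_prod_type, mul_apply,
      conjTranspose_apply, hv, Pi.star_apply]
    rw [Finset.sum_comm]
    exact Finset.sum_congr rfl fun a _ => Finset.sum_congr rfl fun b _ => mul_comm _ _
  set K := link (vecMulVec v (star v)) J with hK
  have hKh : K.IsHermitian := link_isHermitian hω.1.isHermitian hJ
  have hKt := ht _ _ hω
  rw [traceNorm_eq hKh (by simp [hK, trace_link, hJ0])] at hKt
  set L' := L ⊗ₖ (1 : Op D) with hL'
  set M' := M ⊗ₖ (1 : Op D) with hM'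
  have hLM' : L' * M' = 1 := by rw [hL', hM', ← mul_kronecker_mul, hLM, mul_one, one_kronecker_one]
  have hML' : M' * L' = 1 := by rw [hL', hM', ← mul_kronecker_mul, hML, mul_one, one_kronecker_one]
  have hJK : J = L' * K * L'ᴴ := by
    have h1 : M'ᴴ * L'ᴴ = 1 := by rw [← conjTranspose_mul, hLM', conjTranspose_one]
    rw [hK, link_vecMulVec, ← hM']
    calc J = (L' * M') * J * (M'ᴴ * L'ᴴ) := by rw [hLM', h1, one_mul, mul_one]
      _ = _ := by simp only [Matrix.mul_assoc]
  refine ⟨L' * K⁺ * L'ᴴ, ?_, ?_, ?_⟩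
  · exact (nonneg_iff_posSemidef.1 (CFC.posPart_nonneg K)).mul_mul_conjTranspose_same L'
  · have h1 : L' * K⁺ * L'ᴴ - J = L' * (K⁺ - K) * L'ᴴ := by
      conv_lhs => rw [hJK]
      rw [Matrix.mul_sub, Matrix.sub_mul]
    rw [h1]
    exact PosSemidef.mul_mul_conjTranspose_same (le_iff.1 (CFC.le_posPart hKh)) L'
  · have h1 : σ ⊗ₖ (1 : Op D) = M'ᴴ * M' := by
      rw [hM', conjTranspose_kronecker, ← mul_kronecker_mul, hMM, conjTranspose_one, mul_one]
    have h2 : M'ᴴ * M' * (L' * K⁺ * L'ᴴ) = M'ᴴ * (K⁺ * L'ᴴ) := by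
      calc _ = M'ᴴ * ((M' * L') * (K⁺ * L'ᴴ)) := by simp only [Matrix.mul_assoc]
        _ = _ := by rw [hML', Matrix.one_mul]
    rw [trace_mul_traceSnd, h1, h2, Matrix.trace_mul_comm, Matrix.mul_assoc, ← conjTranspose_mul,
      hML', conjTranspose_one, Matrix.mul_one]
    linarith

theorem exists_of_state [Nonempty C] {J : Op (C × D)} {t μ : ℝ} (hJ : J.IsHermitian)
    (hJ0 : traceSnd J = 0)
    (ht : ∀ (r : ℕ) (ω : Op (Fin r × C)), IsState ω → traceNorm (link ω J) ≤ 2 * t)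
    (ht0 : 0 ≤ t) (hμ : t < μ) {σ : Op C} (hσ : IsState σ) :
    ∃ Z : Op (C × D), Z.PosSemidef ∧ (Z - J).PosSemidef ∧ (σ * traceSnd Z).trace.re < μ := by
  have hμ0 : 0 < μ := ht0.trans_lt hμ
  -- Mixing with the maximally mixed state makes `σ` invertible. The weight `s > t / μ` is close
  -- enough to 1 that `s Tr[σ Tr_D Z] ≤ t < s μ`.
  obtain ⟨s, hs1, hs2⟩ := exists_between ((div_lt_one hμ0).2 hμ)
  have hs0 : 0 < s := (div_nonneg ht0 hμ0.le).trans_lt hs1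
  have hd : (0 : ℝ) < Fintype.card C := Nat.cast_pos.2 Fintype.card_pos
  set c : ℝ := (1 - s) / Fintype.card C with hc
  have hc0 : 0 < c := div_pos (by linarith) hd
  obtain ⟨Z, hZ, hZJ, hZt⟩ := exists_of_posDef_state hJ hJ0 ht (σ := s • σ + c • (1 : Op C))
    (PosDef.posSemidef_add (hσ.1.smul hs0.le) (PosDef.one.smul hc0)) (by
      rw [trace_add, trace_smul, trace_smul, hσ.2, trace_one, Complex.real_smul,
        Complex.real_smul, hc]
      push_cast
      rw [div_mul_cancel₀ _ (by exact_mod_cast hd.ne')]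
      ring)
  refine ⟨Z, hZ, hZJ, ?_⟩
  have h1 : 0 ≤ (traceSnd Z).trace.re := by
    have h := trace_mul_traceSnd 1 Z
    rw [one_mul, one_kronecker_one, one_mul] at h
    rw [h]
    exact (Complex.le_def.1 hZ.trace_nonneg).1
  rw [add_mul, smul_mul_assoc, smul_mul_assoc, one_mul, trace_add, trace_smul, trace_smul,
    Complex.add_re, Complex.smul_re, Complex.smul_re, smul_eq_mul, smul_eq_mul] at hZt
  have h2 := mul_nonneg hc0.le h1
  have h3 := (div_lt_iff₀ hμ0).1 hs1
  exact lt_of_mul_lt_mul_left (by linarith) hs0.le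

/-- Strong duality: the optimal bound on the trace norms is attained by feasible points up to an
arbitrarily small error. -/
theorem exists_of_traceNorm_link_le {J : Op (C × D)} {t μ : ℝ} (hJ : J.IsHermitian)
    (hJ0 : traceSnd J = 0)
    (ht : ∀ (r : ℕ) (ω : Op (Fin r × C)), IsState ω → traceNorm (link ω J) ≤ 2 * t)
    (ht0 : 0 ≤ t) (hμ : t < μ) :
    ∃ Z : Op (C × D), Z.PosSemidef ∧ (Z - J).PosSemidef ∧
      ((μ : ℂ) • (1 : Op C) - traceSnd Z).PosSemidef := by
  -- A zero-dimensional input has no states, so minimax is unavailable, but every operator involved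
  -- is zero.
  rcases isEmpty_or_nonempty C with hC | hC
  · refine ⟨0, PosSemidef.zero, ?_, ?_⟩
    · rw [Subsingleton.elim (0 - J) 0]
      exact PosSemidef.zero
    · rw [Subsingleton.elim (_ - _ : Op C) 0]
      exact PosSemidef.zero
  let X := {σ : Op C | IsState σ}
  let Y := {Z : Op (C × D) | Z.PosSemidef ∧ (Z - J).PosSemidef}
  -- The sign puts the compact set of states on the minimizing side, as in Sion's theorem.
  let f : Op C → Op (C × D) → ℝ := fun σ Z => -(σ * traceSnd Z).trace.re
  have hfy (Z : Op (C × D)) : Continuous fun σ => f σ Z :=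
    (Complex.continuous_re.comp (continuous_id.matrix_mul continuous_const).matrix_trace).neg
  have hts : Continuous (traceSnd : Op (C × D) → Op C) := by
    refine continuous_matrix fun a b => continuous_finsetSum _ fun d _ => ?_
    exact continuous_id.matrix_elem _ _
  have hfx (σ : Op C) : Continuous fun Z => f σ Z :=
    (Complex.continuous_re.comp (continuous_const.matrix_mul hts).matrix_trace).neg
  have cX : Convex ℝ X := convex_setOf_isState
  have cY : Convex ℝ Y := by
    rintro Z ⟨hZ, hZJ⟩ W ⟨hW, hWJ⟩ a b ha hb hab
    refine ⟨(hZ.smul ha).add (hW.smul hb), ?_⟩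
    convert (hZJ.smul ha).add (hWJ.smul hb) using 1
    rw [smul_sub, smul_sub, sub_add_sub_comm, ← add_smul, hab, one_smul]
  have hlin (σ τ : Op C) (Z : Op (C × D)) (a b : ℝ) :
      f (a • σ + b • τ) Z = a • f σ Z + b • f τ Z := by
    simp only [f, add_mul, smul_mul_assoc, trace_add, trace_smul, Complex.add_re, Complex.smul_re,
      smul_eq_mul]
    ring
  have hts_lin (Z W : Op (C × D)) (a b : ℝ) :
      traceSnd (a • Z + b • W) = a • traceSnd Z + b • traceSnd W := by
    ext i j
    simp [traceSnd, Finset.sum_add_distrib, Finset.mul_sum]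
  have hlin' (σ : Op C) (Z W : Op (C × D)) (a b : ℝ) :
      f σ (a • Z + b • W) = a • f σ Z + b • f σ W := by
    simp only [f, hts_lin, mul_add, mul_smul_comm, trace_add, trace_smul, Complex.add_re,
      Complex.smul_re, smul_eq_mul]
    ring
  have kX : IsCompact X := isCompact_setOf_isState
  have ne_X : X.Nonempty := by
    refine ⟨Matrix.single hC.some hC.some 1, ?_, trace_single_eq_same _ _⟩
    rw [← diagonal_single]
    refine PosSemidef.diagonal fun i => ?_
    by_cases h : i = hC.some
    · subst h; simp
    · simp [h]
  have hex (σ : Op C) : ∃ Z : Op (C × D), σ ∈ X → Z ∈ Y ∧ -μ < f σ Z := by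
    by_cases hσ : σ ∈ X
    · obtain ⟨Z, h1, h2, h3⟩ := exists_of_state hJ hJ0 ht ht0 hμ hσ
      exact ⟨Z, fun _ => ⟨⟨h1, h2⟩, neg_lt_neg h3⟩⟩
    · exact ⟨0, fun h => absurd h hσ⟩
  choose Zf hZf using hex
  -- Each `Zf σ` remains strictly good near `σ`, so by compactness finitely many of them serve all
  -- states; the finite form of Sion's theorem then yields a single `Z`.
  obtain ⟨T, hTX, hT⟩ := kX.elim_nhds_subcover (fun σ => {τ | -μ < f τ (Zf σ)}) fun σ hσ =>
    (isOpen_lt continuous_const (hfy _)).mem_nhds (hZf σ hσ).2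
  obtain ⟨Z, hZ, hZf⟩ := Sion.exists_lt_iInf_of_lt_iInf_of_finite (f := f) ne_X kX
    (fun Z _ => (hfy Z).lowerSemicontinuous.lowerSemicontinuousOn _)
    (fun Z _ => ConvexOn.quasiconvexOn ⟨cX, fun σ _ τ _ a b _ _ _ => (hlin σ τ Z a b).le⟩)
    cY (fun σ _ => (hfx σ).upperSemicontinuous.upperSemicontinuousOn _)
    (fun σ _ => ConcaveOn.quasiconcaveOn ⟨cY, fun Z _ W _ a b _ _ _ => (hlin' σ Z W a b).ge⟩)
    cX (s := Zf '' T) (T.finite_toSet.image _)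
    (by rintro _ ⟨σ, hσ, rfl⟩; exact (hZf σ (hTX σ hσ)).1) (t := -μ) (fun σ hσ => by
      obtain ⟨τ, hτ, h⟩ := Set.mem_iUnion₂.1 (hT hσ)
      exact ⟨_, ⟨τ, hτ, rfl⟩, h⟩)
  refine ⟨Z, hZ.1, hZ.2, posSemidef_of_forall_isState ?_ fun σ hσ => ?_⟩
  · exact (isHermitian_one.smul (Complex.conj_ofReal μ)).sub (traceSnd_isHermitian hZ.1.isHermitian)
  · have h := hZf σ hσ
    rw [mul_sub, mul_smul_comm, mul_one, trace_sub, trace_smul, hσ.2]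
    simp only [f] at h
    simp only [smul_eq_mul, mul_one, Complex.sub_re, Complex.ofReal_re]
    linarith

/-- Entries of states have modulus at most 1, so the sum of the moduli of the entries of `Tr_D J⁺`
dominates `Tr[σ Tr_D J⁺]` for every `σ`. This gives feasibility of the program and, by weak duality,
finiteness of the diamond distance. -/
theorem exists_feasible {J : Op (C × D)} (hJ : J.IsHermitian) :
    ∃ (μ : ℝ) (Z : Op (C × D)), 0 ≤ μ ∧ Z.PosSemidef ∧ (Z - J).PosSemidef ∧
      ((μ : ℂ) • (1 : Op C) - traceSnd Z).PosSemidef := by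
  have hP := nonneg_iff_posSemidef.1 (CFC.posPart_nonneg J)
  refine ⟨∑ i, ∑ j, ‖traceSnd J⁺ j i‖, J⁺, by positivity, hP,
    le_iff.1 (CFC.le_posPart hJ), ?_⟩
  refine posSemidef_of_forall_isState ((isHermitian_one.smul (Complex.conj_ofReal _)).sub
    (traceSnd_isHermitian hP.isHermitian)) fun σ hσ => ?_
  rw [mul_sub, mul_smul_comm, mul_one, trace_sub, trace_smul, hσ.2, smul_eq_mul, mul_one,
    Complex.sub_re, Complex.ofReal_re, sub_nonneg]
  simp only [Matrix.trace, diag_apply, mul_apply, Complex.re_sum]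
  refine Finset.sum_le_sum fun i _ => Finset.sum_le_sum fun j _ => (Complex.re_le_norm _).trans ?_
  rw [norm_mul]
  exact mul_le_of_le_one_left (norm_nonneg _) (hσ.norm_apply_le_one i j)

end Duality

/-! ### Diamond distance as a semi-definite program -/

section DiamondDistance

variable {C D : Type*} [Fintype C] [Fintype D] [DecidableEq C] [DecidableEq D]
  {Φ Ψ : Op C →ₗ[ℂ] Op D}

omit [Fintype D] [DecidableEq D] in
theorem idTensor_sub_idTensor (Φ Ψ : Op C →ₗ[ℂ] Op D) {R : Type*} (ω : Op (R × C)) :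
    idTensor R Φ ω - idTensor R Ψ ω = link ω (choi Φ - choi Ψ) := by
  rw [idTensor_eq_link, idTensor_eq_link, link_sub]

omit [DecidableEq C] in
theorem diamondDist_nonneg (Φ Ψ : Op C →ₗ[ℂ] Op D) : 0 ≤ diamondDist Φ Ψ :=
  Real.sSup_nonneg (by rintro _ ⟨r, ω, -, rfl⟩; exact traceNorm_nonneg _)

omit [DecidableEq D] in
theorem traceSnd_choi_sub (hΦ : IsTracePreserving Φ) (hΨ : IsTracePreserving Ψ) :
    traceSnd (choi Φ - choi Ψ) = 0 := by
  rw [traceSnd_sub, (isTracePreserving_iff_choi Φ).1 hΦ, (isTracePreserving_iff_choi Ψ).1 hΨ,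
    sub_self]

theorem traceNorm_idTensor_sub_le {Z : Op (C × D)} {μ : ℝ} (hΦ : IsTracePreserving Φ)
    (hΨ : IsTracePreserving Ψ) (hJ : (choi Φ - choi Ψ).IsHermitian) (hZ : Z.PosSemidef)
    (hZJ : (Z - (choi Φ - choi Ψ)).PosSemidef)
    (hμ : ((μ : ℂ) • (1 : Op C) - traceSnd Z).PosSemidef)
    {r : ℕ} {ω : Op (Fin r × C)} (hω : IsState ω) :
    traceNorm (idTensor (Fin r) Φ ω - idTensor (Fin r) Ψ ω) ≤ 2 * μ := by
  rw [idTensor_sub_idTensor]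
  exact traceNorm_link_le hω hJ (traceSnd_choi_sub hΦ hΨ) hZ hZJ hμ

theorem diamondDist_le {Z : Op (C × D)} {μ : ℝ} (hΦ : IsTracePreserving Φ)
    (hΨ : IsTracePreserving Ψ) (hJ : (choi Φ - choi Ψ).IsHermitian) (hZ : Z.PosSemidef)
    (hZJ : (Z - (choi Φ - choi Ψ)).PosSemidef)
    (hμ : ((μ : ℂ) • (1 : Op C) - traceSnd Z).PosSemidef) (hμ0 : 0 ≤ μ) :
    diamondDist Φ Ψ ≤ 2 * μ := by
  -- `0 ≤ μ` covers the case of no input states, where the supremum is 0 by convention.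
  refine Real.sSup_le ?_ (by linarith)
  rintro _ ⟨r, ω, hω, rfl⟩
  exact traceNorm_idTensor_sub_le hΦ hΨ hJ hZ hZJ hμ hω

theorem exists_of_diamondDist_lt {μ : ℝ} (hΦ : IsTracePreserving Φ)
    (hΨ : IsTracePreserving Ψ) (hJ : (choi Φ - choi Ψ).IsHermitian)
    (hμ : 1 / 2 * diamondDist Φ Ψ < μ) :
    ∃ Z : Op (C × D), Z.PosSemidef ∧ (Z - (choi Φ - choi Ψ)).PosSemidef ∧
      ((μ : ℂ) • (1 : Op C) - traceSnd Z).PosSemidef := by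
  obtain ⟨b, Z, -, hZ, hZJ, hb⟩ := exists_feasible hJ
  refine exists_of_traceNorm_link_le hJ (traceSnd_choi_sub hΦ hΨ) (fun r ω hω => ?_)
    (mul_nonneg (by norm_num) (diamondDist_nonneg Φ Ψ)) hμ
  rw [← mul_assoc, mul_one_div_cancel two_ne_zero, one_mul, ← idTensor_sub_idTensor]
  -- A real `sSup` dominates its set only if the set is bounded above; the feasible point `(b, Z)`
  -- supplies the bound.
  refine le_csSup ⟨2 * b, ?_⟩ ⟨r, ω, hω, rfl⟩
  rintro _ ⟨r, ω, hω, rfl⟩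
  exact traceNorm_idTensor_sub_le hΦ hΨ hJ hZ hZJ hb hω

end DiamondDistance

/-! ### Partial transposes, the resource state and the main theorem -/

section Parties

variable {ι : Type*} [DecidableEq ι] [Fintype ι]

section PartialTranspose

variable {B C : ι → Type*} [∀ i, DecidableEq (B i)]

omit [Fintype ι] [∀ i, DecidableEq (B i)] in
theorem piecewise_eq_piecewise_swap_iff (S : Finset ι) (x y : ∀ i, B i) :
    S.piecewise y x = S.piecewise x y ↔ x = y := by
  refine ⟨fun h => ?_, fun h => by rw [h]⟩
  ext i
  have hi := congrFun h i
  by_cases hS : i ∈ S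
  · simpa [hS] using hi.symm
  · simpa [hS] using hi

theorem partialTranspose_single (S : Finset ι) (a b : ∀ i, B i) :
    partialTranspose S (Matrix.single a b (1 : ℂ)) =
      Matrix.single (S.piecewise b a) (S.piecewise a b) 1 := by
  have key (x y u v : ∀ i, B i) (h : u = S.piecewise y x ∧ v = S.piecewise x y) :
      S.piecewise v u = x ∧ S.piecewise u v = y := by
    rw [h.1, h.2]
    constructor <;> ext i <;> by_cases hi : i ∈ S <;> simp [hi]
  ext x y
  change (if _ then _ else _) = (if _ then _ else _)
  exact if_congr ⟨key x y a b, fun h => by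
    have := key a b x y ⟨h.1.symm, h.2.symm⟩
    exact ⟨this.1.symm, this.2.symm⟩⟩ rfl rfl

/-- A partial transpose permutes matrix units, so transposing the input of the map exchanges the
input labels of its Choi operator. -/
theorem choi_partialTranspose (S : Finset ι) (P : Op (∀ i, B i) →ₗ[ℂ] Op (∀ i, C i)) :
    choi (partialTranspose S ∘ₗ P ∘ₗ partialTranspose S) = partialTransposeInOut S (choi P) := by
  ext p q
  rw [choi_apply, LinearMap.comp_apply, LinearMap.comp_apply, partialTranspose_single]
  simp only [partialTransposeInOut, of_apply, choi_apply]
  rfl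

variable [∀ i, Fintype (B i)] [∀ i, Fintype (C i)]

/-- A linear map is a C-PPT-P channel iff its Choi operator satisfies the constraints of the
semi-definite program. -/
theorem isCPPTP_iff_choi (P : Op (∀ i, B i) →ₗ[ℂ] Op (∀ i, C i)) :
    IsCPPTP P ↔ (choi P).PosSemidef ∧ traceSnd (choi P) = 1 ∧
      ∀ S : Finset ι, (partialTransposeInOut S (choi P)).PosSemidef := by
  simp only [IsCPPTP, IsChannel, isCompletelyPositive_iff_choi, isTracePreserving_iff_choi,
    choi_partialTranspose, and_assoc]

end PartialTranspose

variable {A Ahat A' : ι → Type*}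
  [∀ i, Fintype (A i)] [∀ i, Fintype (Ahat i)] [∀ i, Fintype (A' i)]
  [∀ i, DecidableEq (A i)] [∀ i, DecidableEq (Ahat i)] [∀ i, DecidableEq (A' i)]

omit [∀ i, DecidableEq (Ahat i)] in
theorem contractResource_apply (ρ : Op (∀ i, Ahat i)) (P : Op ((∀ i, A i × Ahat i) × (∀ i, A' i)))
    (p q : (∀ i, A i) × (∀ i, A' i)) :
    contractResource ρ P p q = ∑ h, ∑ k, ρ k h *
      P ((Equiv.arrowProdEquivProdArrow ι A Ahat).symm (p.1, k), p.2)
        ((Equiv.arrowProdEquivProdArrow ι A Ahat).symm (q.1, h), q.2) := by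
  simp only [contractResource, of_apply, mul_apply, kroneckerMap_apply, Fintype.sum_prod_type,
    one_apply, transpose_apply, submatrix_apply, ite_mul, one_mul, zero_mul, mul_ite, mul_one,
    mul_zero, Finset.sum_ite_irrel, Finset.sum_const_zero, Finset.sum_ite_eq, Finset.mem_univ,
    if_true]
  rfl

omit [∀ i, DecidableEq (Ahat i)] in
theorem contractResource_isHermitian {ρ : Op (∀ i, Ahat i)}
    {P : Op ((∀ i, A i × Ahat i) × (∀ i, A' i))} (hρ : ρ.IsHermitian) (hP : P.IsHermitian) :
    (contractResource ρ P).IsHermitian := by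
  ext p q
  simp only [conjTranspose_apply, contractResource_apply, star_sum, star_mul', hρ.apply, hP.apply]
  exact Finset.sum_comm

/-- Both sides have entries `∑ ρ k h * P((a,k),·)((b,h),·)`: feeding in a matrix unit of `A` leaves
`ρ` contracted entrywise with the Choi operator, which as a matrix product is multiplication by the
transpose of `ρ`. -/
theorem choi_simulation (P : Op (∀ i, A i × Ahat i) →ₗ[ℂ] Op (∀ i, A' i))
    (ρ : Op (∀ i, Ahat i)) : choi (simulation P ρ) = contractResource ρ (choi P) := by
  ext p q
  rw [choi_apply, contractResource_apply]
  have h : simulation P ρ (Matrix.single p.1 q.1 1) p.2 q.2 =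
    P (jointInput (Matrix.single p.1 q.1 1) ρ) p.2 q.2 := rfl
  rw [h, apply_eq_sum_choi]
  let e := Equiv.arrowProdEquivProdArrow ι A Ahat
  rw [← e.symm.sum_comp, Fintype.sum_prod_type]
  simp_rw [← e.symm.sum_comp (fun b => jointInput _ ρ _ b * _), Fintype.sum_prod_type]
  simp only [jointInput, submatrix_apply, e, Equiv.apply_symm_apply, kroneckerMap_apply,
    single_apply, ite_and, ite_mul, one_mul, zero_mul, Finset.sum_ite_irrel,
    Finset.sum_const_zero, Finset.sum_ite_eq, Finset.mem_univ, if_true]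
  rw [Finset.sum_comm]

omit [∀ i, DecidableEq (A i)] [∀ i, DecidableEq (Ahat i)] in
theorem trace_jointInput (ω : Op (∀ i, A i)) (ρ : Op (∀ i, Ahat i)) :
    (jointInput ω ρ).trace = ω.trace * ρ.trace := by
  rw [← trace_kronecker]
  exact (Equiv.arrowProdEquivProdArrow ι A Ahat).sum_comp fun x => (ω ⊗ₖ ρ) x x

omit [∀ i, DecidableEq (A i)] [∀ i, DecidableEq (Ahat i)] [∀ i, DecidableEq (A' i)] in
theorem simulation_isTracePreserving {P : Op (∀ i, A i × Ahat i) →ₗ[ℂ] Op (∀ i, A' i)}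
    {ρ : Op (∀ i, Ahat i)} (hP : IsTracePreserving P) (hρ : ρ.trace = 1) :
    IsTracePreserving (simulation P ρ) := fun ω =>
  (hP (jointInput ω ρ)).trans (by rw [trace_jointInput, hρ, mul_one])

/-- The completely depolarizing channel works: its Choi operator is a multiple of the identity,
which all partial transposes fix. -/
theorem exists_isCPPTP {B C : ι → Type*} [∀ i, Fintype (B i)] [∀ i, Fintype (C i)]
    [∀ i, DecidableEq (B i)] [∀ i, DecidableEq (C i)]
    (h : Nonempty (∀ i, B i) → Nonempty (∀ i, C i)) :
    ∃ P : Op (∀ i, B i) →ₗ[ℂ] Op (∀ i, C i), IsCPPTP P := by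
  set c : ℝ := (Fintype.card (∀ i, C i) : ℝ)⁻¹ with hc
  have hpos : (c • (1 : Op ((∀ i, B i) × (∀ i, C i)))).PosSemidef :=
    PosSemidef.one.smul (inv_nonneg.2 (Nat.cast_nonneg _))
  refine ⟨ofChoi (c • 1), (isCPPTP_iff_choi _).2 ?_⟩
  rw [choi_ofChoi]
  refine ⟨hpos, ?_, fun S => ?_⟩
  · ext a b
    have := h ⟨a⟩
    have hn : (Fintype.card (∀ i, C i) : ℂ) ≠ 0 := Nat.cast_ne_zero.2 Fintype.card_ne_zero
    by_cases hab : a = b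
    · subst hab
      simp [traceSnd, hc, hn, -Fintype.card_pi]
    · simp [traceSnd, one_apply, hab]
  · convert hpos using 1
    ext p q
    change (c • (1 : Op ((∀ i, B i) × (∀ i, C i)))) _ _ = _
    simp only [Matrix.smul_apply, one_apply, Prod.ext_iff, piecewise_eq_piecewise_swap_iff]

/-- The choice `P = choi 𝒫` identifies the feasible points of the semi-definite program with
certificates for the diamond distance between `N` and the simulation by `𝒫`. -/
theorem sdpFeasible_iff {N : Op (∀ i, A i) →ₗ[ℂ] Op (∀ i, A' i)} {ρ : Op (∀ i, Ahat i)}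
    {μ : ℝ} {Z : Op ((∀ i, A i) × (∀ i, A' i))}
    (P : Op (∀ i, A i × Ahat i) →ₗ[ℂ] Op (∀ i, A' i)) :
    SDPFeasible N ρ μ Z (choi P) ↔ IsCPPTP P ∧ 0 ≤ μ ∧ Z.PosSemidef ∧
      ((μ : ℂ) • (1 : Op (∀ i, A i)) - traceSnd Z).PosSemidef ∧
      (Z - (choi N - choi (simulation P ρ))).PosSemidef := by
  rw [isCPPTP_iff_choi, choi_simulation]
  exact ⟨fun h => ⟨⟨h.P_nonneg, h.trace_eq, h.ppt⟩, h.mu_nonneg, h.Z_nonneg, h.trace_le,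
    h.diff_le⟩, fun ⟨⟨h1, h2, h3⟩, h4, h5, h6, h7⟩ => ⟨h4, h5, h1, h6, h2, h7, h3⟩⟩

theorem choi_sub_choi_simulation_isHermitian {N : Op (∀ i, A i) →ₗ[ℂ] Op (∀ i, A' i)}
    {ρ : Op (∀ i, Ahat i)} {P : Op (∀ i, A i × Ahat i) →ₗ[ℂ] Op (∀ i, A' i)}
    (hN : IsChannel N) (hρ : IsState ρ) (hP : IsCPPTP P) :
    (choi N - choi (simulation P ρ)).IsHermitian := by
  rw [choi_simulation]
  exact ((isCompletelyPositive_iff_choi N).1 hN.1).isHermitian.sub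
    (contractResource_isHermitian hρ.1.isHermitian ((isCPPTP_iff_choi P).1 hP).1.isHermitian)


/-- The simulation error is the value of the semi-definite program, which is feasible. -/
theorem ePPT_eq_sInf {N : Op (∀ i, A i) →ₗ[ℂ] Op (∀ i, A' i)} {ρ : Op (∀ i, Ahat i)}
    (hN : IsChannel N) (hρ : IsState ρ) :
    {μ : ℝ | ∃ Z P, SDPFeasible N ρ μ Z P}.Nonempty ∧
      ePPT N ρ = sInf {μ : ℝ | ∃ Z P, SDPFeasible N ρ μ Z P} := by
  -- A trace-preserving map cannot send a nonzero input system to a zero-dimensional output.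
  have hout : Nonempty (∀ i, A i × Ahat i) → Nonempty (∀ i, A' i) := by
    rintro ⟨x⟩
    by_contra hE
    rw [not_nonempty_iff] at hE
    have h := hN.2 (Matrix.single (fun i => (x i).1) (fun i => (x i).1) 1)
    rw [Matrix.trace_single_eq_same, Matrix.trace_eq_zero_of_isEmpty] at h
    exact zero_ne_one h
  obtain ⟨P₀, hP₀⟩ := exists_isCPPTP hout
  have hne : {μ : ℝ | ∃ Z P, SDPFeasible N ρ μ Z P}.Nonempty := by
    obtain ⟨μ, Z, h1, h2, h3, h4⟩ :=
      exists_feasible (choi_sub_choi_simulation_isHermitian hN hρ hP₀)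
    exact ⟨μ, Z, choi P₀, (sdpFeasible_iff P₀).2 ⟨hP₀, h1, h2, h4, h3⟩⟩
  have hnonneg (P : Op (∀ i, A i × Ahat i) →ₗ[ℂ] Op (∀ i, A' i)) : 0 ≤ simError N ρ P :=
    mul_nonneg (by norm_num) (diamondDist_nonneg _ _)
  have hne' : {e | ∃ P : Op (∀ i, A i × Ahat i) →ₗ[ℂ] Op (∀ i, A' i),
      IsCPPTP P ∧ e = simError N ρ P}.Nonempty := ⟨_, P₀, hP₀, rfl⟩
  refine ⟨hne, le_antisymm (le_csInf hne ?_) (le_csInf hne' ?_)⟩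
  · rintro μ ⟨Z, J, h⟩
    -- Every feasible `J` is the Choi operator of a C-PPT-P channel, whose error weak duality bounds
    -- by `μ`.
    rw [← choi_ofChoi J, sdpFeasible_iff] at h
    obtain ⟨hP, h1, h2, h3, h4⟩ := h
    refine le_trans (b := simError N ρ (ofChoi J)) (csInf_le ⟨0, ?_⟩ ⟨_, hP, rfl⟩) ?_
    · rintro _ ⟨P, -, rfl⟩
      exact hnonneg P
    · have := diamondDist_le hN.2 (simulation_isTracePreserving hP.1.2 hρ.2)
        (choi_sub_choi_simulation_isHermitian hN hρ hP) h2 h4 h3 h1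
      unfold simError
      linarith
  · rintro _ ⟨P, hP, rfl⟩
    -- Strong duality yields a `Z` only for `μ` strictly above the error, which suffices for the
    -- infimum.
    refine le_of_forall_gt_imp_ge_of_dense fun μ hμ => csInf_le ⟨0, ?_⟩ ?_
    · rintro _ ⟨Z, J, h⟩
      exact h.mu_nonneg
    · obtain ⟨Z, h1, h2, h3⟩ := exists_of_diamondDist_lt hN.2
        (simulation_isTracePreserving hP.1.2 hρ.2)
        (choi_sub_choi_simulation_isHermitian hN hρ hP) hμ
      exact ⟨Z, choi P, (sdpFeasible_iff P).2 ⟨hP, (hnonneg P).trans hμ.le, h1, h3, h2⟩⟩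

end Parties

end ChannelSim

theorem mainTheorem10 {ι : Type*} [Fintype ι] [DecidableEq ι] {A Ahat A' : ι → Type*}
    [∀ i, Fintype (A i)] [∀ i, Fintype (Ahat i)] [∀ i, Fintype (A' i)]
    [∀ i, DecidableEq (A i)] [∀ i, DecidableEq (Ahat i)] [∀ i, DecidableEq (A' i)]
    (N : ChannelSim.Op (∀ i, A i) →ₗ[ℂ] ChannelSim.Op (∀ i, A' i))
    (ρ : ChannelSim.Op (∀ i, Ahat i))
    (hN : ChannelSim.IsChannel N) (hρ : ChannelSim.IsState ρ) :
    {μ : ℝ | ∃ Z P, ChannelSim.SDPFeasible N ρ μ Z P}.Nonempty ∧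
      ChannelSim.ePPT N ρ = sInf {μ : ℝ | ∃ Z P, ChannelSim.SDPFeasible N ρ μ Z P} :=
  ChannelSim.ePPT_eq_sInf hN hρ
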